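/- Let $k\ge 2$, let $\mathcal A_k$ be an alphabet with $k$ letters, and let $x\in\mathcal A_k^{\mathbb Z}$ be an Arnoux-Rauzy sequence: every factor of $x$ occurs in $x$ with bounded gaps, $x$ has exactly $(k-1)n+1$ factors of length $n$ for each $n$, and for each $n$ exactly one factor of length $n$ is right-special (has at least two one-letter extensions to the right that are factors) and exactly one is left-special (defined analogously). Let $X$ be the two-sided subshift of $x$, that is, the set of all $y\in\mathcal A_k^{\mathbb Z}$ with the same factors as $x$. Let $\nu$ be the (unique) shift-invariant Borel probability measure on $X$. Let $w_1,w_2,\dots$ be the bispecial factors (both right- and left-special) of $x$, listed so that $|w_1|<|w_2|<\cdots$. The index sequence $(i_n)_{n\ge1}$ of $X$ is defined by letting $i_n\in\mathcal A_k$ be the unique letter for which the word $i_nw_n$ is right-special. A $2$-run of $(i_n)$ is a pair $(a,l)\in\mathcal A_k\times\mathbb N$ such that $i_l=i_{l+1}=a$. Let $f:\mathcal A_k\to\mathbb R$ be a non-constant function. For $y\in X$, let $H_y$ be the bounded self-adjoint operator on $\ell^2(\mathbb Z)$ given by $$(H_y\phi)(n)=\phi(n+1)+\phi(n-1)+f(y_n)\,\phi(n).$$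 Let $\sigma_{\mathrm{pp}}(H_y)$ be the spectrum of the restriction of $H_y$ to the closed subspace of those $\phi\in\ell^2(\mathbb Z)$ whose spectral measure $\mu_\phi$, given by $\langle\phi,(H_y-z)^{-1}\phi\rangle=\int_{\mathbb R}\frac{d\mu_\phi(t)}{t-z}$ for $\operatorname{Im}z>0$, is pure point (i.e. carried by a countable set). If the index sequence $(i_n)$ contains infinitely many $2$-runs, then $\sigma_{\mathrm{pp}}(H_y)=\emptyset$ for $\nu$-almost every $y\in X$. -/

import Mathlib

namespace ArnouxRauzy

/-! ### Words, factors and Arnoux-Rauzy sequences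

The alphabet with `k` letters is `Fin k`; finite words are lists. -/

/-- The factors (subwords) of length `n` of a two-sided sequence. -/
def factorsOfLength {k : ℕ} (x : ℤ → Fin k) (n : ℕ) : Set (List (Fin k)) :=
  {w | ∃ j : ℤ, w = List.ofFn (fun m : Fin n => x (j + (m : ℕ)))}

/-- The set of all factors of `x`. -/
def factors {k : ℕ} (x : ℤ → Fin k) : Set (List (Fin k)) :=
  {w | ∃ n : ℕ, w ∈ factorsOfLength x n}

/-- A factor with at least two extensions to the right. -/
def IsRightSpecial {k : ℕ} (x : ℤ → Fin k) (u : List (Fin k)) : Prop :=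
  u ∈ factors x ∧ ∃ a b : Fin k, a ≠ b ∧ u ++ [a] ∈ factors x ∧ u ++ [b] ∈ factors x

/-- A factor with at least two extensions to the left. -/
def IsLeftSpecial {k : ℕ} (x : ℤ → Fin k) (u : List (Fin k)) : Prop :=
  u ∈ factors x ∧ ∃ a b : Fin k, a ≠ b ∧ a :: u ∈ factors x ∧ b :: u ∈ factors x

/-- A factor that is both right-special and left-special. -/
def IsBispecial {k : ℕ} (x : ℤ → Fin k) (u : List (Fin k)) : Prop :=
  IsRightSpecial x u ∧ IsLeftSpecial x u

/-- Every factor of `x` occurs in `x` with bounded gaps. -/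
def IsUniformlyRecurrent {k : ℕ} (x : ℤ → Fin k) : Prop :=
  ∀ w ∈ factors x, ∃ N : ℕ, ∀ j : ℤ, ∃ m : ℤ, j ≤ m ∧ m ≤ j + N ∧
    w = List.ofFn (fun l : Fin w.length => x (m + (l : ℕ)))

/-- Two-sided Arnoux-Rauzy sequences over the alphabet with `k` letters (used for `2 ≤ k`). -/
structure IsArnouxRauzy {k : ℕ} (x : ℤ → Fin k) : Prop where
  uniformlyRecurrent : IsUniformlyRecurrent x
  complexity : ∀ n : ℕ, (factorsOfLength x n).ncard = (k - 1) * n + 1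
  rightSpecial : ∀ n : ℕ, ∃! u : List (Fin k), u ∈ factorsOfLength x n ∧ IsRightSpecial x u
  leftSpecial : ∀ n : ℕ, ∃! u : List (Fin k), u ∈ factorsOfLength x n ∧ IsLeftSpecial x u

/-- The two-sided subshift of `x`: all two-sided sequences with the same factors as `x`. -/
def subshift {k : ℕ} (x : ℤ → Fin k) : Set (ℤ → Fin k) :=
  {y | ∀ n : ℕ, factorsOfLength y n = factorsOfLength x n}

/-- The left shift. -/
def shift {k : ℕ} (x : ℤ → Fin k) : ℤ → Fin k := fun n => x (n + 1)

/-- `i` is the index sequence of (the subshift of) `x`: if `w 0, w 1, …` are all the bispecial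
factors, listed by increasing length, then `i n` is the letter such that the word `(i n) (w n)`
is right-special. For an Arnoux-Rauzy sequence there is exactly one such `i`. The numbering
starts at `0`. -/
def IsIndexSequence {k : ℕ} (x : ℤ → Fin k) (i : ℕ → Fin k) : Prop :=
  ∃ w : ℕ → List (Fin k), StrictMono (fun n => (w n).length) ∧
    Set.range w = {u | IsBispecial x u} ∧ ∀ n, IsRightSpecial x (i n :: w n)

/-- The pair `(a, l)` is an `r`-run of the sequence `i`. -/
def IsRun {k : ℕ} (i : ℕ → Fin k) (r : ℕ) (p : Fin k × ℕ) : Prop :=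
  ∀ m : ℕ, p.2 ≤ m → m < p.2 + r → i m = p.1

/-! ### Schrödinger operators on `ℓ²(ℤ)` -/

/-- The complex Hilbert space `ℓ²(ℤ)`. -/
abbrev EllTwo : Type := lp (fun _ : ℤ => ℂ) 2

lemma summable_sq (φ : EllTwo) : Summable (fun n : ℤ => ‖φ n‖ ^ 2) := by
  have h := (lp.memℓp φ).summable (by norm_num)
  simpa using h

lemma memEllTwo_of_summable {u : ℤ → ℂ} (h : Summable (fun n : ℤ => ‖u n‖ ^ 2)) :
    Memℓp u 2 :=
  memℓp_gen (by simpa using h)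

lemma norm_sq_eq (φ : EllTwo) : ‖φ‖ ^ 2 = ∑' n : ℤ, ‖φ n‖ ^ 2 := by
  have h := lp.norm_rpow_eq_tsum (p := 2) (by norm_num) φ
  simpa using h

lemma translate_mem (s : ℤ) (φ : EllTwo) : Memℓp (fun n : ℤ => φ (n + s)) 2 :=
  memEllTwo_of_summable ((Equiv.addRight s).summable_iff.2 (summable_sq φ))

/-- Translation by `s`: `(T φ)(n) = φ(n + s)`. -/
noncomputable def translate (s : ℤ) : EllTwo →L[ℂ] EllTwo :=
  LinearMap.mkContinuous
    { toFun := fun φ => (⟨fun n : ℤ => φ (n + s), translate_mem s φ⟩ : EllTwo)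
      map_add' := fun φ ψ => by ext n; rfl
      map_smul' := fun c φ => by ext n; rfl }
    1 (fun φ => by
      rw [one_mul]
      refine le_of_sq_le_sq ?_ (norm_nonneg _)
      rw [norm_sq_eq, norm_sq_eq]
      exact le_of_eq ((Equiv.addRight s).tsum_eq (fun n : ℤ => ‖φ n‖ ^ 2)))

lemma multiply_bound {V : ℤ → ℝ} {C : ℝ} (hC : ∀ n, |V n| ≤ C) (φ : EllTwo) (n : ℤ) :
    ‖(V n : ℂ) * φ n‖ ^ 2 ≤ C ^ 2 * ‖φ n‖ ^ 2 := by
  rw [norm_mul, mul_pow, Complex.norm_real, Real.norm_eq_abs]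
  gcongr
  exact hC n

lemma multiply_mem {V : ℤ → ℝ} (hV : ∃ C : ℝ, ∀ n, |V n| ≤ C) (φ : EllTwo) :
    Memℓp (fun n : ℤ => (V n : ℂ) * φ n) 2 := by
  obtain ⟨C, hC⟩ := hV
  exact memEllTwo_of_summable (Summable.of_nonneg_of_le (fun n => by positivity)
    (multiply_bound hC φ) ((summable_sq φ).mul_left _))

/-- Multiplication by a bounded real function. -/
noncomputable def multiply (V : ℤ → ℝ) (hV : ∃ C : ℝ, ∀ n, |V n| ≤ C) : EllTwo →L[ℂ] EllTwo :=
  LinearMap.mkContinuousOfExistsBound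
    { toFun := fun φ => (⟨fun n : ℤ => (V n : ℂ) * φ n, multiply_mem hV φ⟩ : EllTwo)
      map_add' := fun φ ψ => by ext n; exact mul_add _ _ _
      map_smul' := fun c φ => by ext n; exact mul_left_comm _ _ _ }
    (by
      obtain ⟨C, hC⟩ := hV
      refine ⟨C, fun φ => ?_⟩
      have hC0 : 0 ≤ C := (abs_nonneg _).trans (hC 0)
      refine le_of_sq_le_sq ?_ (by positivity)
      rw [norm_sq_eq, mul_pow, norm_sq_eq, ← tsum_mul_left]
      exact Summable.tsum_le_tsum (multiply_bound hC φ)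
        (Summable.of_nonneg_of_le (fun n => by positivity)
          (multiply_bound hC φ) ((summable_sq φ).mul_left _))
        ((summable_sq φ).mul_left _))

/-- The discrete Schrödinger operator with bounded potential `V`. -/
noncomputable def schrodinger (V : ℤ → ℝ) (hV : ∃ C : ℝ, ∀ n, |V n| ≤ C) :
    EllTwo →L[ℂ] EllTwo :=
  translate 1 + translate (-1) + multiply V hV

lemma schrodinger_apply (V : ℤ → ℝ) (hV : ∃ C : ℝ, ∀ n, |V n| ≤ C) (φ : EllTwo) (n : ℤ) :
    schrodinger V hV φ n = φ (n + 1) + φ (n - 1) + (V n : ℂ) * φ n := rfl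

lemma potential_bounded {k : ℕ} (f : Fin k → ℝ) (y : ℤ → Fin k) :
    ∃ C : ℝ, ∀ n : ℤ, |f (y n)| ≤ C :=
  ⟨∑ a : Fin k, |f a|, fun n =>
    Finset.single_le_sum (f := fun a => |f a|) (fun _ _ => abs_nonneg _) (Finset.mem_univ (y n))⟩

/-- The operator with potential `V(n) = f (y n)`. -/
noncomputable def symbolicSchrodinger {k : ℕ} (f : Fin k → ℝ) (y : ℤ → Fin k) :
    EllTwo →L[ℂ] EllTwo :=
  schrodinger (fun n => f (y n)) (potential_bounded f y)

/-! ### Spectral measures and pure point spectrum -/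

/-- `μ` is the spectral measure of `φ`: its Borel transform is `z ↦ ⟨φ, (H - z)⁻¹ φ⟩` on the
upper half plane. -/
def IsSpectralMeasure (H : EllTwo →L[ℂ] EllTwo) (φ : EllTwo) (μ : MeasureTheory.Measure ℝ) :
    Prop :=
  MeasureTheory.IsFiniteMeasure μ ∧ ∀ z : ℂ, 0 < z.im →
    inner ℂ φ (Ring.inverse (H - z • (1 : EllTwo →L[ℂ] EllTwo)) φ) = ∫ t : ℝ, 1 / ((t : ℂ) - z) ∂μ

/-- A measure on the line that is carried by a countable set. -/
def IsPurePoint (μ : MeasureTheory.Measure ℝ) : Prop :=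
  ∃ S : Set ℝ, S.Countable ∧ μ Sᶜ = 0

/-- The vectors whose spectral measure is pure point (for self-adjoint `H`, a closed subspace
that is invariant under `H`). -/
def purePointSpace (H : EllTwo →L[ℂ] EllTwo) : Set EllTwo :=
  {φ | ∃ μ : MeasureTheory.Measure ℝ, IsSpectralMeasure H φ μ ∧ IsPurePoint μ}

/-- The spectrum of the restriction of `H` to its pure point space: the complex numbers `z` for
which `H - z` is not a bijection of that space onto itself (a bijective bounded operator on a
closed subspace has a bounded inverse). -/
def purePointSpectrum (H : EllTwo →L[ℂ] EllTwo) : Set ℂ :=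
  {z | ¬ Set.BijOn (fun φ => H φ - z • φ) (purePointSpace H) (purePointSpace H)}

end ArnouxRauzy

/-!
The operator `H_y` has no eigenvectors for almost every `y`, because almost every `y` contains
arbitrarily long cubes around some site.

*Cubes.* Let `w` be a bispecial factor of `x`. The letters that follow the successive occurrences
of `w` in `x` code `x` as a sequence of return paths of lengths `ℓ b`. Counting one-letter
extensions and using recurrence shows that there is a letter `c` which separates all the others in this coding
(`ReturnStructure.exists_separating_letter`). Hence the next bispecial factor has length
`|w| + ℓ c`, and its return lengths are `ℓ c` for `c` and `ℓ c + ℓ b` for `b ≠ c`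
(`ReturnStructure.exists_next`). By induction `ℓ b ≤ |w| + 1`, so a bispecial factor recurs with
gaps bounded by its length plus one. Let `w 0, w 1, …` be the bispecial factors and `c n` the
separating letters. If `c j = c m` with `j < m` successive occurrences of this letter, the return
path of `w m` for it has length `q = |w m| - |w j|`. If the letter occurs once more at an index
`i > m`, then `w (i + 1)` contains a factor of length `3 q + |w j|` with period `q`, which provides
`|w j| + 1` starting points of cubes. Any `2 k + 1` consecutive values of `c` contain one letter
three times, and `|w n| + 1` at most doubles with `n`; so the cubes of period `q` begin at a
proportion of sites that is bounded below independently of `q`, and `q` may be chosen arbitrarily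
large (`IsArnouxRauzy.exists_frequent_cubes`).

*Almost every sequence.* The set of `y` that have, around some site, cubes of arbitrarily long
periods is shift invariant. On its complement the invariant measure `ν` would still give the cubes
of each period a fixed proportion of the mass, so the complement is null
(`IsArnouxRauzy.ae_frequently_three_blocks`). Neither ergodicity nor uniqueness of `ν` enters.

*Eigenvectors.* Over three consecutive equal blocks the Cayley-Hamilton theorem for the transfer
matrix of one block bounds a solution of `H_y u = E u` at the centre by its values one or two
blocks away (`norm_le_of_three_blocks`). A square summable solution tends to zero, so it vanishes.

*Spectral measures.* The mass at `s` of the spectral measure of `φ` is the limit of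
`-iε ⟨φ, (H - s - iε)⁻¹ φ⟩` as `ε → 0`, which is zero when `H - s` is injective. Therefore a
pure point spectral measure is zero and `φ = 0`; the pure point space is trivial
(`purePointSpectrum_eq_empty`).
-/

namespace ArnouxRauzy

/-! ### Factors and special factors -/

section Factors

variable {k : ℕ} {x : ℤ → Fin k}

/-- The factor of length `n` of `x` that starts at `p`. -/
def factorAt (x : ℤ → Fin k) (p : ℤ) (n : ℕ) : List (Fin k) :=
  List.ofFn fun m : Fin n => x (p + (m : ℕ))

lemma length_factorAt (p : ℤ) (n : ℕ) : (factorAt x p n).length = n := List.length_ofFn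

lemma factorAt_eq_iff {p p' : ℤ} {n : ℕ} :
    factorAt x p n = factorAt x p' n ↔ ∀ t : ℕ, t < n → x (p + t) = x (p' + t) := by
  rw [factorAt, factorAt, List.ofFn_inj, funext_iff]
  exact ⟨fun h t ht => h ⟨t, ht⟩, fun h t => h t t.2⟩

lemma factorAt_mem (p : ℤ) (n : ℕ) : factorAt x p n ∈ factorsOfLength x n := ⟨p, rfl⟩

lemma factorAt_mem_factors (p : ℤ) (n : ℕ) : factorAt x p n ∈ factors x := ⟨n, p, rfl⟩

lemma factorAt_succ (p : ℤ) (n : ℕ) : factorAt x p (n + 1) = x p :: factorAt x (p + 1) n := by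
  rw [factorAt, List.ofFn_succ, factorAt]
  simp [add_assoc, add_comm (1 : ℤ)]

lemma factorAt_succ' (p : ℤ) (n : ℕ) :
    factorAt x p (n + 1) = factorAt x p n ++ [x (p + n)] := by
  rw [factorAt, List.ofFn_succ_last, factorAt]
  simp

lemma factorAt_of_le {p p' : ℤ} {m n : ℕ} (hmn : m ≤ n)
    (h : factorAt x p n = factorAt x p' n) : factorAt x p m = factorAt x p' m :=
  factorAt_eq_iff.2 fun t ht => factorAt_eq_iff.1 h t (ht.trans_le hmn)

lemma factorAt_apply {p p' : ℤ} {n : ℕ} (h : factorAt x p n = factorAt x p' n) {s : ℤ}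
    (h0 : 0 ≤ s) (hs : s < n) : x (p + s) = x (p' + s) := by
  lift s to ℕ using h0
  exact factorAt_eq_iff.1 h s (by exact_mod_cast hs)

lemma factorAt_append {p p' : ℤ} {m n : ℕ} (h : factorAt x p m = factorAt x p' m)
    (h' : factorAt x (p + m) n = factorAt x (p' + m) n) :
    factorAt x p (m + n) = factorAt x p' (m + n) := by
  refine factorAt_eq_iff.2 fun t ht => ?_
  rcases lt_or_ge t m with htm | htm
  · exact factorAt_eq_iff.1 h t htm
  · have := factorAt_eq_iff.1 h' (t - m) (by omega)
    rwa [Nat.cast_sub htm, add_assoc, add_sub_cancel, add_assoc, add_sub_cancel] at this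

lemma factorAt_shift {p p' : ℤ} {m n : ℕ} (h : factorAt x p (m + n) = factorAt x p' (m + n)) :
    factorAt x (p + m) n = factorAt x (p' + m) n := by
  refine factorAt_eq_iff.2 fun t ht => ?_
  have := factorAt_eq_iff.1 h (m + t) (by omega)
  push_cast at this
  rwa [← add_assoc, ← add_assoc] at this

lemma mem_factors_append {p : ℤ} {n : ℕ} {a : Fin k} :
    factorAt x p n ++ [a] ∈ factors x ↔
      ∃ p', factorAt x p' n = factorAt x p n ∧ x (p' + n) = a := by
  constructor
  · rintro ⟨m, j, hj⟩
    change _ = factorAt x j m at hj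
    have hm : m = n + 1 := by
      have := congrArg List.length hj
      simp only [List.length_append, length_factorAt, List.length_singleton] at this
      exact this.symm
    rw [hm, factorAt_succ'] at hj
    obtain ⟨h1, h2⟩ := List.append_inj' hj rfl
    exact ⟨j, h1.symm, (List.singleton_inj.1 h2).symm⟩
  · rintro ⟨p', h1, h2⟩
    rw [← h1, ← h2, ← factorAt_succ']
    exact factorAt_mem_factors _ _

lemma mem_factors_cons {p : ℤ} {n : ℕ} {a : Fin k} :
    a :: factorAt x p n ∈ factors x ↔
      ∃ p', factorAt x p' n = factorAt x p n ∧ x (p' - 1) = a := by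
  constructor
  · rintro ⟨m, j, hj⟩
    change _ = factorAt x j m at hj
    have hm : m = n + 1 := by
      have := congrArg List.length hj
      simp only [List.length_cons, length_factorAt] at this
      exact this.symm
    rw [hm, factorAt_succ] at hj
    obtain ⟨h1, h2⟩ := List.cons.inj hj
    exact ⟨j + 1, h2.symm, by rw [add_sub_cancel_right, h1]⟩
  · rintro ⟨p', h1, h2⟩
    have := factorAt_mem_factors (x := x) (p' - 1) (n + 1)
    rwa [factorAt_succ, sub_add_cancel, h1, h2] at this

lemma finite_factorsOfLength (x : ℤ → Fin k) (n : ℕ) : (factorsOfLength x n).Finite := by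
  refine (List.finite_length_eq (Fin k) n).subset ?_
  rintro _ ⟨j, rfl⟩
  exact List.length_ofFn

/-- Let `ext a w` stand for `a :: w` or for `w ++ [a]`. Exactly `k - 1` factors are gained from
length `n` to length `n + 1`; if every factor of length `n` other than `u` has only one extension,
all of them are extensions of `u`, which therefore has the maximal number `k`. -/
lemma IsArnouxRauzy.forall_extension (hx : IsArnouxRauzy x) {n : ℕ}
    {ext : Fin k → List (Fin k) → List (Fin k)}
    (hext : ∀ v ∈ factorsOfLength x (n + 1), ∃ a, ∃ w ∈ factorsOfLength x n, ext a w = v)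
    {u : List (Fin k)} (hu : u ∈ factorsOfLength x n)
    (huniq : ∀ w ∈ factorsOfLength x n, ∀ a b, ext a w ∈ factors x → ext b w ∈ factors x →
      a ≠ b → w = u) (a : Fin k) : ext a u ∈ factors x := by
  classical
  by_contra hau
  have hk : 0 < k := a.pos
  have : Nonempty (Fin k) := ⟨a⟩
  choose! A W hW hAW using hext
  set F := (finite_factorsOfLength x n).toFinset with hF
  set G := (finite_factorsOfLength x (n + 1)).toFinset with hG
  have hFcard : F.card = (k - 1) * n + 1 := by
    rw [← hx.complexity n, Set.ncard_eq_toFinset_card _ (finite_factorsOfLength x n)]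
  have hGcard : G.card = (k - 1) * (n + 1) + 1 := by
    rw [← hx.complexity (n + 1), Set.ncard_eq_toFinset_card _ (finite_factorsOfLength x (n + 1))]
  have hGmem : ∀ v ∈ G, v ∈ factorsOfLength x (n + 1) := fun v hv => by simpa [hG] using hv
  -- the extensions of `u` miss the letter `a`, and the other factors of length `n + 1` inject
  -- into the factors of length `n` other than `u`
  have h1 : (G.filter fun v => W v = u).card ≤ (Finset.univ.erase a).card := by
    refine Finset.card_le_card_of_injOn A (fun v hv => ?_) fun v hv v' hv' h => ?_
    · obtain ⟨hvG, hvu⟩ := Finset.mem_filter.1 hv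
      refine Finset.mem_coe.2 (Finset.mem_erase.2 ⟨fun h => hau ?_, Finset.mem_univ _⟩)
      have := hAW v (hGmem v hvG)
      rw [h, hvu] at this
      rw [this]
      exact ⟨_, hGmem v hvG⟩
    · obtain ⟨hvG, hvu⟩ := Finset.mem_filter.1 hv
      obtain ⟨hvG', hvu'⟩ := Finset.mem_filter.1 hv'
      rw [← hAW v (hGmem v hvG), ← hAW v' (hGmem v' hvG'), hvu, hvu', h]
  have h2 : (G.filter fun v => ¬ W v = u).card ≤ (F.erase u).card := by
    refine Finset.card_le_card_of_injOn W (fun v hv => ?_) fun v hv v' hv' h => ?_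
    · obtain ⟨hvG, hvu⟩ := Finset.mem_filter.1 hv
      exact Finset.mem_coe.2 (Finset.mem_erase.2 ⟨hvu, by simpa [hF] using hW v (hGmem v hvG)⟩)
    · obtain ⟨hvG, hvu⟩ := Finset.mem_filter.1 hv
      obtain ⟨hvG', -⟩ := Finset.mem_filter.1 hv'
      have e := hAW v (hGmem v hvG)
      have e' := hAW v' (hGmem v' hvG')
      rw [← h] at e'
      by_contra hne
      refine hvu (huniq _ (hW v (hGmem v hvG)) (A v) (A v') ?_ ?_ fun hA => hne ?_)
      · rw [e]; exact ⟨_, hGmem v hvG⟩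
      · rw [e']; exact ⟨_, hGmem v' hvG'⟩
      · rw [← e, ← e', hA]
  have h3 := Finset.card_filter_add_card_filter_not (s := G) (fun v => W v = u)
  rw [Finset.card_erase_of_mem (Finset.mem_univ a), Finset.card_univ, Fintype.card_fin] at h1
  rw [Finset.card_erase_of_mem (by simpa [hF] using hu), hFcard] at h2
  rw [hGcard] at h3
  have : (k - 1) * (n + 1) = (k - 1) * n + (k - 1) := by ring
  omega

/-- The right-special factor of length `n` is followed by every letter, and a factor of length
`n` followed by two different letters is that one. -/
lemma IsArnouxRauzy.exists_right (hx : IsArnouxRauzy x) (n : ℕ) :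
    ∃ p, (∀ a, ∃ p', factorAt x p' n = factorAt x p n ∧ x (p' + n) = a) ∧
      ∀ r r', factorAt x r n = factorAt x r' n → x (r + n) ≠ x (r' + n) →
        factorAt x r n = factorAt x p n := by
  obtain ⟨_, ⟨⟨p, rfl⟩, -⟩, huniq⟩ := hx.rightSpecial n
  change ∀ v, _ → v = factorAt x p n at huniq
  refine ⟨p, fun a => mem_factors_append.1 (hx.forall_extension (ext := fun a w => w ++ [a])
    ?_ (factorAt_mem p n) ?_ a), fun r r' h hne => ?_⟩
  · rintro _ ⟨j, rfl⟩
    exact ⟨x (j + n), factorAt x j n, factorAt_mem j n, (factorAt_succ' j n).symm⟩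
  · intro w hw a b ha hb hab
    exact huniq w ⟨hw, ⟨n, hw⟩, a, b, hab, ha, hb⟩
  · exact huniq _ ⟨factorAt_mem r n, factorAt_mem_factors r n, x (r + n), x (r' + n), hne,
      mem_factors_append.2 ⟨r, rfl, rfl⟩, mem_factors_append.2 ⟨r', h.symm, rfl⟩⟩

/-- The left-special factor of length `n` is preceded by every letter, and a factor of length
`n` preceded by two different letters is that one. -/
lemma IsArnouxRauzy.exists_left (hx : IsArnouxRauzy x) (n : ℕ) :
    ∃ p, (∀ a, ∃ p', factorAt x p' n = factorAt x p n ∧ x (p' - 1) = a) ∧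
      ∀ r r', factorAt x r n = factorAt x r' n → x (r - 1) ≠ x (r' - 1) →
        factorAt x r n = factorAt x p n := by
  obtain ⟨_, ⟨⟨p, rfl⟩, -⟩, huniq⟩ := hx.leftSpecial n
  change ∀ v, _ → v = factorAt x p n at huniq
  refine ⟨p, fun a => mem_factors_cons.1 (hx.forall_extension (ext := fun a w => a :: w)
    ?_ (factorAt_mem p n) ?_ a), fun r r' h hne => ?_⟩
  · rintro _ ⟨j, rfl⟩
    exact ⟨x j, factorAt x (j + 1) n, factorAt_mem _ n, (factorAt_succ j n).symm⟩
  · intro w hw a b ha hb hab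
    exact huniq w ⟨hw, ⟨n, hw⟩, a, b, hab, ha, hb⟩
  · exact huniq _ ⟨factorAt_mem r n, factorAt_mem_factors r n, x (r - 1), x (r' - 1), hne,
      mem_factors_cons.2 ⟨r, rfl, rfl⟩, mem_factors_cons.2 ⟨r', h.symm, rfl⟩⟩

lemma IsUniformlyRecurrent.exists_gap (hx : IsUniformlyRecurrent x) (p : ℤ) (n : ℕ) :
    ∃ N : ℕ, ∀ j : ℤ, ∃ m, j ≤ m ∧ m ≤ j + N ∧ factorAt x m n = factorAt x p n := by
  obtain ⟨N, hN⟩ := hx _ (factorAt_mem_factors p n)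
  refine ⟨N, fun j => ?_⟩
  obtain ⟨m, h1, h2, h3⟩ := hN j
  refine ⟨m, h1, h2, ?_⟩
  change _ = factorAt x m _ at h3
  rw [length_factorAt] at h3
  exact h3.symm

end Factors

/-! ### Return words of bispecial factors -/

section Returns

variable {k : ℕ} {x : ℤ → Fin k}

/-- The return structure of a bispecial factor `w` of `x`: `S` is the set of positions at which
`w` occurs, `L` is the length of `w`, and an occurrence of `w` that is followed by the letter `b`
has its next occurrence at distance `ℓ b`. -/
structure ReturnStructure (x : ℤ → Fin k) (S : Set ℤ) (L : ℕ) (ℓ : Fin k → ℕ) : Prop where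
  mem_iff : ∀ p ∈ S, ∀ p', p' ∈ S ↔ factorAt x p' L = factorAt x p L
  next : ∀ p ∈ S, p + ℓ (x (p + L)) ∈ S
  pos : ∀ b, 1 ≤ ℓ b
  next_le : ∀ p ∈ S, ∀ s ∈ S, p < s → p + ℓ (x (p + L)) ≤ s
  loop : ∀ p ∈ S, ∀ p' ∈ S, x (p + L) = x (p' + L) →
    factorAt x p (L + ℓ (x (p + L))) = factorAt x p' (L + ℓ (x (p + L)))
  right : ∀ b, ∃ p ∈ S, x (p + L) = b
  left : ∀ a, ∃ p ∈ S, x (p - 1) = a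
  le_length : ∀ b, ℓ b ≤ L + 1
  prev : ∀ s ∈ S, ∃ p ∈ S, p + ℓ (x (p + L)) = s

/-- The return structure of the empty word. -/
lemma IsArnouxRauzy.returnStructure_nil (hx : IsArnouxRauzy x) :
    ReturnStructure x Set.univ 0 (fun _ => 1) where
  mem_iff p _ p' := by simp [factorAt_eq_iff]
  next _ _ := trivial
  pos _ := le_rfl
  next_le p _ s _ h := by push_cast; omega
  loop p _ p' _ h := factorAt_eq_iff.2 fun t ht => by
    obtain rfl : t = 0 := by omega
    exact h
  right b := by
    obtain ⟨p, hp, -⟩ := hx.exists_right 0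
    obtain ⟨p', -, h⟩ := hp b
    exact ⟨p', trivial, h⟩
  left a := by
    obtain ⟨p, hp, -⟩ := hx.exists_left 0
    obtain ⟨p', -, h⟩ := hp a
    exact ⟨p', trivial, h⟩
  le_length _ := by simp
  prev s _ := ⟨s - 1, trivial, by simp⟩

namespace ReturnStructure

variable {S : Set ℤ} {L : ℕ} {ℓ : Fin k → ℕ}

/-- The letter `d` for which `w d` is left-special. -/
lemma exists_left_letter (h : ReturnStructure x S L ℓ) (hk : 2 ≤ k) (hx : IsArnouxRauzy x) :
    ∃ d, ∀ a, ∃ p ∈ S, x (p + L) = d ∧ x (p - 1) = a := by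
  obtain ⟨p, hp, -⟩ := hx.exists_left (L + 1)
  obtain ⟨pl, -, huniq⟩ := hx.exists_left L
  let a : Fin k := ⟨0, by omega⟩
  let b : Fin k := ⟨1, by omega⟩
  have hab : a ≠ b := by simp [a, b]
  obtain ⟨s, hs, hsa⟩ := h.left a
  obtain ⟨s', hs', hsb⟩ := h.left b
  obtain ⟨q, hq, hqa⟩ := hp a
  obtain ⟨q', hq', hqb⟩ := hp b
  have h1 := huniq s s' ((h.mem_iff s' hs' s).1 hs) (by rw [hsa, hsb]; exact hab)
  have h2 := huniq q q' (factorAt_of_le (Nat.le_succ L) (hq.trans hq'.symm))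
    (by rw [hqa, hqb]; exact hab)
  refine ⟨x (p + L), fun a' => ?_⟩
  obtain ⟨r, hr, hra⟩ := hp a'
  refine ⟨r, (h.mem_iff s hs r).2 ?_, factorAt_apply hr (by positivity) (by push_cast; omega), hra⟩
  rw [h1, ← h2]
  exact factorAt_of_le (Nat.le_succ L) (hr.trans hq.symm)

/-- The letter `a` for which `a w` is right-special. -/
lemma exists_right_letter (h : ReturnStructure x S L ℓ) (hk : 2 ≤ k) (hx : IsArnouxRauzy x) :
    ∃ a, (∀ b, ∃ p ∈ S, x (p - 1) = a ∧ x (p + L) = b) ∧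
      ∀ p ∈ S, ∀ p' ∈ S, x (p - 1) = x (p' - 1) → x (p + L) ≠ x (p' + L) → x (p - 1) = a := by
  obtain ⟨p, hp, huniq'⟩ := hx.exists_right (L + 1)
  obtain ⟨pl, -, huniq⟩ := hx.exists_right L
  let a : Fin k := ⟨0, by omega⟩
  let b : Fin k := ⟨1, by omega⟩
  have hab : a ≠ b := by simp [a, b]
  obtain ⟨s, hs, hsa⟩ := h.right a
  obtain ⟨s', hs', hsb⟩ := h.right b
  have hadd : ∀ r : ℤ, r + ((L + 1 : ℕ) : ℤ) = r + 1 + L := fun r => by push_cast; ring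
  have htail : ∀ {r r'}, factorAt x r (L + 1) = factorAt x r' (L + 1) →
      factorAt x (r + 1) L = factorAt x (r' + 1) L := fun {r r'} hr => by
    rw [add_comm L] at hr
    exact_mod_cast factorAt_shift hr
  obtain ⟨q, hq, hqa⟩ := hp a
  obtain ⟨q', hq', hqb⟩ := hp b
  rw [hadd] at hqa hqb
  have h1 := huniq s s' ((h.mem_iff s' hs' s).1 hs) (by rw [hsa, hsb]; exact hab)
  have h2 := huniq (q + 1) (q' + 1) (htail (hq.trans hq'.symm)) (by rw [hqa, hqb]; exact hab)
  refine ⟨x p, fun b' => ?_, fun r hr r' hr' hleft hright => ?_⟩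
  · obtain ⟨r, hr, hrb⟩ := hp b'
    refine ⟨r + 1, (h.mem_iff s hs _).2 ?_, ?_, by rw [← hadd, hrb]⟩
    · rw [h1, ← h2]
      exact htail (hr.trans hq.symm)
    · rw [add_sub_cancel_right]
      simpa using factorAt_eq_iff.1 hr 0 (by omega)
  · have h3 := huniq' (r - 1) (r' - 1) ?_ ?_
    · simpa using factorAt_eq_iff.1 h3 0 (by omega)
    · rw [factorAt_succ, factorAt_succ, sub_add_cancel, sub_add_cancel, hleft,
        (h.mem_iff r' hr' r).1 hr]
    · rwa [hadd, hadd, sub_add_cancel, sub_add_cancel]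

/-- If every occurrence of `w d` is followed by an occurrence of `w d`, then only `d` follows
`w`: the sequence is `w d`-periodic to the right of some position, hence everywhere by
recurrence. -/
lemma eq_of_loop_repeats (h : ReturnStructure x S L ℓ) (hx : IsUniformlyRecurrent x) {d : Fin k}
    (hd : ∀ p ∈ S, x (p + L) = d → x (p + ℓ d + L) = d) (c : Fin k) : c = d := by
  obtain ⟨p, hp, hpd⟩ := h.right d
  obtain ⟨r, hr, hrc⟩ := h.right c
  obtain ⟨N, hN⟩ := hx.exists_gap r (L + 1)
  obtain ⟨s, hps, -, hsr⟩ := hN p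
  have hs : s ∈ S := (h.mem_iff r hr s).2 (factorAt_of_le (Nat.le_succ L) hsr)
  have hsc : x (s + L) = c := by
    rw [← hrc]
    exact factorAt_apply hsr (by positivity) (by push_cast; omega)
  have hchain : ∀ n : ℕ, p + n * ℓ d ∈ S ∧ x (p + n * ℓ d + L) = d := by
    intro n
    induction n with
    | zero => simpa using ⟨hp, hpd⟩
    | succ n ih =>
      have h1 := h.next _ ih.1
      have h2 := hd _ ih.1 ih.2
      rw [ih.2] at h1
      push_cast
      rw [add_mul, one_mul, ← add_assoc]
      exact ⟨h1, h2⟩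
  have hℓ : (0 : ℤ) < ℓ d := by exact_mod_cast h.pos d
  obtain ⟨n, hn⟩ := Int.eq_ofNat_of_zero_le (Int.ediv_nonneg (sub_nonneg.2 hps) hℓ.le)
  obtain ⟨h1, h2⟩ := hchain n
  have h3 := Int.mul_ediv_add_emod (s - p) (ℓ d)
  have h4 := Int.emod_nonneg (s - p) hℓ.ne'
  have h5 := Int.emod_lt_of_pos (s - p) hℓ
  rw [hn, mul_comm] at h3
  change (n : ℤ) * ℓ d + _ = _ at h3
  have h6 : s = p + n * ℓ d := by
    by_contra hne
    have := h.next_le _ h1 s hs (lt_of_le_of_ne (by omega) (Ne.symm hne))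
    rw [h2] at this
    omega
  rw [← hsc, h6, h2]

/-- One letter `c` separates all the others in the sequence of letters that follow the
occurrences of `w`: any letter may come after `c`, and after another letter comes `c`. Moreover
`w c` is left-special. -/
lemma exists_separating_letter (h : ReturnStructure x S L ℓ) (hk : 2 ≤ k)
    (hx : IsArnouxRauzy x) :
    ∃ c, (∀ b, ∃ p ∈ S, x (p + L) = c ∧ x (p + ℓ c + L) = b) ∧
      (∀ p ∈ S, x (p + L) ≠ c → x (p + ℓ (x (p + L)) + L) = c) ∧
      ∀ a, ∃ p ∈ S, x (p + L) = c ∧ x (p - 1) = a := by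
  obtain ⟨d, hd⟩ := h.exists_left_letter hk hx
  obtain ⟨a₀, ha₀, huniq⟩ := h.exists_right_letter hk hx
  -- `α b` is the last letter before the next occurrence of `w`, after an occurrence of `w b`
  obtain ⟨α, hα⟩ : ∃ α : Fin k → Fin k, ∀ p ∈ S, x (p + ℓ (x (p + L)) - 1) = α (x (p + L)) := by
    choose r hr hrb using h.right
    refine ⟨fun b => x (r b + ℓ b - 1), fun p hp => ?_⟩
    have h1 := h.loop p hp _ (hr (x (p + L))) (hrb _).symm
    have h2 := h.pos (x (p + L))
    have h3 := factorAt_apply h1 (s := (ℓ (x (p + L)) : ℤ) - 1) (by omega) (by push_cast; omega)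
    rwa [← add_sub_assoc, ← add_sub_assoc] at h3
  have hsurj : Function.Surjective α := by
    intro a
    obtain ⟨p, hp, -, hpa⟩ := hd a
    obtain ⟨r, hr, rfl⟩ := h.prev p hp
    exact ⟨_, (hα r hr).symm.trans hpa⟩
  have hinj : Function.Injective α := Finite.injective_iff_surjective.2 hsurj
  -- `w d` is preceded by every letter, hence by every return path
  have hfollow : ∀ b, ∃ r ∈ S, x (r + L) = b ∧ x (r + ℓ b + L) = d := by
    intro b
    obtain ⟨p, hp, hpd, hpa⟩ := hd (α b)
    obtain ⟨r, hr, rfl⟩ := h.prev p hp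
    have hrb : x (r + L) = b := hinj ((hα r hr).symm.trans hpa)
    rw [hrb] at hpd
    exact ⟨r, hr, hrb, hpd⟩
  -- the return path that ends with `a₀` is the only one with more than one continuation
  obtain ⟨c, hc⟩ := hsurj a₀
  have h1 : ∀ b, ∃ p ∈ S, x (p + L) = c ∧ x (p + ℓ c + L) = b := by
    intro b
    obtain ⟨p, hp, hpa, hpb⟩ := ha₀ b
    obtain ⟨r, hr, rfl⟩ := h.prev p hp
    have hrc : x (r + L) = c := hinj (((hα r hr).symm.trans hpa).trans hc.symm)
    rw [hrc] at hpb
    exact ⟨r, hr, hrc, hpb⟩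
  have h2 : ∀ p ∈ S, x (p + L) ≠ c → x (p + ℓ (x (p + L)) + L) = d := by
    intro p hp hpc
    obtain ⟨r, hr, hrb, hrd⟩ := hfollow (x (p + L))
    by_contra hne
    have hnext := h.next r hr
    have hαr := hα r hr
    rw [hrb] at hnext hαr
    have := huniq _ (h.next p hp) _ hnext ((hα p hp).trans hαr.symm) (by rw [hrd]; exact hne)
    exact hpc (hinj (((hα p hp).symm.trans this).trans hc.symm))
  have hdc : c = d := by
    by_contra hne
    refine hne (h.eq_of_loop_repeats hx.uniformlyRecurrent (fun p hp hpd => ?_) c)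
    have := h2 p hp (by rw [hpd]; exact Ne.symm hne)
    rwa [hpd] at this
  subst hdc
  exact ⟨c, h1, h2, hd⟩

/-- The next bispecial factor: it extends `w` by the return path that begins with the separating
letter. -/
lemma exists_next (h : ReturnStructure x S L ℓ) (hk : 2 ≤ k) (hx : IsArnouxRauzy x) :
    ∃ c, ReturnStructure x {p | p ∈ S ∧ x (p + L) = c} (L + ℓ c)
      (fun b => if b = c then ℓ c else ℓ c + ℓ b) := by
  obtain ⟨c, hright, hsep, hleft⟩ := h.exists_separating_letter hk hx
  have hadd : ∀ p : ℤ, p + ((L + ℓ c : ℕ) : ℤ) = p + ℓ c + L := fun p => by push_cast; ring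
  have hnext : ∀ p ∈ S, x (p + L) = c → p + ℓ c ∈ S := fun p hp hpc => by
    have := h.next p hp
    rwa [hpc] at this
  have hloop : ∀ p ∈ S, ∀ p' ∈ S, ∀ b, x (p + L) = b → x (p' + L) = b →
      factorAt x p (L + ℓ b) = factorAt x p' (L + ℓ b) := by
    rintro p hp p' hp' _ rfl hb
    exact h.loop p hp p' hp' hb.symm
  have hsep' : ∀ p ∈ S, ∀ b, x (p + L) = b → b ≠ c → p + ℓ b ∈ S ∧ x (p + ℓ b + L) = c := by
    rintro p hp _ rfl hb
    exact ⟨h.next p hp, hsep p hp hb⟩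
  refine ⟨c, ⟨?_, ?_, ?_, ?_, ?_, ?_, ?_, ?_, ?_⟩⟩
  · rintro p ⟨hp, hpc⟩ p'
    constructor
    · rintro ⟨hp', hpc'⟩
      exact hloop p' hp' p hp c hpc' hpc
    · intro hpp
      refine ⟨(h.mem_iff p hp p').2 (factorAt_of_le (Nat.le_add_right _ _) hpp), ?_⟩
      rw [← hpc]
      have := h.pos c
      exact factorAt_apply hpp (by positivity) (by push_cast; omega)
  · rintro p ⟨hp, hpc⟩
    have h1 := hnext p hp hpc
    simp only [hadd]
    split_ifs with hb
    · exact ⟨h1, hb⟩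
    · push_cast
      rw [← add_assoc]
      exact hsep' _ h1 _ rfl hb
  · intro b
    have := h.pos c
    split_ifs <;> omega
  · rintro p ⟨hp, hpc⟩ s ⟨hs, hsc⟩ hps
    have h1 := hnext p hp hpc
    have h2 := h.next_le p hp s hs hps
    rw [hpc] at h2
    simp only [hadd]
    split_ifs with hb
    · exact h2
    · push_cast
      rw [← add_assoc]
      refine h.next_le _ h1 s hs (lt_of_le_of_ne h2 ?_)
      rintro rfl
      exact hb hsc
  · rintro p ⟨hp, hpc⟩ p' ⟨hp', hpc'⟩ hpp
    simp only [hadd] at hpp ⊢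
    have h1 := hnext p hp hpc
    have h1' := hnext p' hp' hpc'
    have e := hloop p hp p' hp' c hpc hpc'
    split_ifs with hb
    · have e1 := hloop _ h1 _ h1' c hb (hpp.symm.trans hb)
      have := factorAt_append (factorAt_of_le (Nat.le_add_left (ℓ c) L) e) e1
      rwa [← add_assoc, add_comm (ℓ c) L] at this
    · obtain ⟨h2, h2c⟩ := hsep' _ h1 _ rfl hb
      obtain ⟨h2', h2c'⟩ := hsep' _ h1' _ hpp.symm hb
      have e1 := hloop _ h1 _ h1' _ rfl hpp.symm
      have e2 := hloop _ h2 _ h2' c h2c h2c'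
      have := factorAt_append (factorAt_of_le (Nat.le_add_left (ℓ c) L) e)
        (factorAt_append (factorAt_of_le (Nat.le_add_left _ L) e1) e2)
      refine factorAt_of_le (le_of_eq ?_) this
      omega
  · intro b
    obtain ⟨p, hp, hpc, hpb⟩ := hright b
    exact ⟨p, ⟨hp, hpc⟩, by rw [hadd, hpb]⟩
  · intro a
    obtain ⟨p, hp, hpc, hpa⟩ := hleft a
    exact ⟨p, ⟨hp, hpc⟩, hpa⟩
  · intro b
    have h1 := h.le_length b
    have h2 := h.le_length c
    split_ifs <;> omega
  · rintro s ⟨hs, hsc⟩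
    obtain ⟨r, hr, rfl⟩ := h.prev s hs
    by_cases hb : x (r + L) = c
    · refine ⟨r, ⟨hr, hb⟩, ?_⟩
      rw [hb] at hsc
      simp only [hadd]
      rw [if_pos hsc, hb]
    · obtain ⟨p, hp, rfl⟩ := h.prev r hr
      have hpc : x (p + L) = c := by
        by_contra hpc
        exact hb (hsep p hp hpc)
      rw [hpc] at hb hsc ⊢
      refine ⟨p, ⟨hp, hpc⟩, ?_⟩
      simp only [hadd]
      rw [if_neg hb]
      push_cast
      ring

/-- The occurrences of `w` have gaps of length at most `L + 1`. -/
lemma exists_mem_between (h : ReturnStructure x S L ℓ) (hk : 2 ≤ k) (r : ℤ) :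
    ∃ s ∈ S, r ≤ s ∧ s ≤ r + L := by
  obtain ⟨s₀, hs₀, -⟩ := h.right ⟨0, by omega⟩
  have hback : ∀ n : ℕ, ∃ s ∈ S, s ≤ s₀ - n := by
    intro n
    induction n with
    | zero => exact ⟨s₀, hs₀, by simp⟩
    | succ n ih =>
      obtain ⟨s, hs, hsn⟩ := ih
      obtain ⟨p, hp, hps⟩ := h.prev s hs
      have := h.pos (x (p + L))
      exact ⟨p, hp, by push_cast; omega⟩
  obtain ⟨s₁, hs₁, hs₁r⟩ := hback (s₀ - r + 1).toNat
  obtain ⟨p, ⟨hp, hpr⟩, hmax⟩ := Int.exists_greatest_of_bdd (P := fun s => s ∈ S ∧ s < r)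
    ⟨r, fun s hs => hs.2.le⟩ ⟨s₁, hs₁, by omega⟩
  have h1 := h.le_length (x (p + L))
  have h2 := h.pos (x (p + L))
  refine ⟨_, h.next p hp, ?_, by omega⟩
  by_contra hlt
  have := hmax _ ⟨h.next p hp, by omega⟩
  omega

end ReturnStructure

end Returns

/-! ### The tower of bispecial factors and its cubes -/

section Towers

open Filter

variable {k : ℕ} {x : ℤ → Fin k}

/-- The return structures of a sequence of bispecial factors `w 0, w 1, …`, in which `w (n + 1)`
is the next bispecial factor after `w n` and begins with `w n` followed by the letter `c n`. -/
structure BispecialTower (x : ℤ → Fin k) (S : ℕ → Set ℤ) (L : ℕ → ℕ) (ℓ : ℕ → Fin k → ℕ)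
    (c : ℕ → Fin k) : Prop where
  level : ∀ n, ReturnStructure x (S n) (L n) (ℓ n)
  mem_succ : ∀ n p, p ∈ S (n + 1) ↔ p ∈ S n ∧ x (p + L n) = c n
  length_succ : ∀ n, L (n + 1) = L n + ℓ n (c n)
  return_succ : ∀ n b, ℓ (n + 1) b = if b = c n then ℓ n (c n) else ℓ n (c n) + ℓ n b

lemma IsArnouxRauzy.exists_tower (hk : 2 ≤ k) (hx : IsArnouxRauzy x) :
    ∃ S L ℓ c, BispecialTower x S L ℓ c := by
  choose C hC using fun (D : Σ' (S : Set ℤ) (L : ℕ) (ℓ : Fin k → ℕ), ReturnStructure x S L ℓ) =>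
    D.2.2.2.exists_next hk hx
  let D : ℕ → Σ' (S : Set ℤ) (L : ℕ) (ℓ : Fin k → ℕ), ReturnStructure x S L ℓ :=
    fun n => Nat.rec ⟨_, _, _, hx.returnStructure_nil⟩ (fun _ D => ⟨_, _, _, hC D⟩) n
  exact ⟨fun n => (D n).1, fun n => (D n).2.1, fun n => (D n).2.2.1, fun n => C (D n),
    ⟨fun n => (D n).2.2.2, fun _ _ => Iff.rfl, fun _ => rfl, fun _ _ => rfl⟩⟩

namespace BispecialTower

variable {S : ℕ → Set ℤ} {L : ℕ → ℕ} {ℓ : ℕ → Fin k → ℕ} {c : ℕ → Fin k}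

lemma mem_of_le (h : BispecialTower x S L ℓ c) {m n : ℕ} (hmn : m ≤ n) {p : ℤ} (hp : p ∈ S n) :
    p ∈ S m := by
  induction n, hmn using Nat.le_induction with
  | base => exact hp
  | succ n _ ih => exact ih ((h.mem_succ n p).1 hp).1

lemma add_mem (h : BispecialTower x S L ℓ c) {n : ℕ} {p : ℤ} (hp : p ∈ S (n + 1)) :
    p + ℓ n (c n) ∈ S n := by
  obtain ⟨h1, h2⟩ := (h.mem_succ n p).1 hp
  have := (h.level n).next p h1
  rwa [h2] at this

/-- The word `w m` is a suffix of `w n` for `m ≤ n`. -/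
lemma suffix_mem (h : BispecialTower x S L ℓ c) {m n : ℕ} (hmn : m ≤ n) {p : ℤ} (hp : p ∈ S n) :
    p + L n - L m ∈ S m := by
  induction n, hmn using Nat.le_induction generalizing p with
  | base => simpa using hp
  | succ n _ ih =>
    have := ih (h.add_mem hp)
    rw [h.length_succ]
    push_cast
    rwa [add_comm (L n : ℤ), ← add_assoc]

/-- A constant tail of `c` would make the word `w (N + m)` a long power, in which no occurrence
of `w N` is followed by a second letter. -/
lemma exists_ne (h : BispecialTower x S L ℓ c) (hk : 2 ≤ k) (hx : IsUniformlyRecurrent x)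
    (N : ℕ) : ∃ n, N ≤ n ∧ c (n + 1) ≠ c n := by
  by_contra! hcon
  obtain ⟨d, hd⟩ : ∃ d, ∀ m, c (N + m) = d := by
    refine ⟨c N, fun m => ?_⟩
    induction m with
    | zero => rfl
    | succ m ih => rw [← add_assoc, hcon _ (Nat.le_add_right N m), ih]
  obtain ⟨b, hb⟩ : ∃ b, b ≠ d := by
    have : Nontrivial (Fin k) := Fin.nontrivial_iff_two_le.2 hk
    exact _root_.exists_ne d
  have hℓ : ∀ m, ℓ (N + m) d = ℓ N d := by
    intro m
    induction m with
    | zero => rfl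
    | succ m ih => rw [← add_assoc, h.return_succ, hd, if_pos rfl, ih]
  have hrun : ∀ m, ∀ p ∈ S (N + m), ∀ s ∈ S N, p ≤ s → s < p + m → x (s + L N) = d := by
    intro m
    induction m with
    | zero =>
      intro p _ s _ h1 h2
      push_cast at h2
      omega
    | succ m ih =>
      intro p hp s hs hps hsp
      obtain ⟨hpN, hpd⟩ := (h.mem_succ N p).1 (h.mem_of_le (by omega) hp)
      have hd0 : c N = d := hd 0
      rw [hd0] at hpd
      rcases hps.eq_or_lt with rfl | hlt
      · exact hpd
      · have h1 := (h.level N).next_le p hpN s hs hlt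
        have h2 := (h.level N).pos d
        have h3 : p + ℓ (N + m) (c (N + m)) ∈ S (N + m) := h.add_mem hp
        rw [hd, hℓ] at h3
        rw [hpd] at h1
        push_cast at hsp
        exact ih _ h3 s hs h1 (by omega)
  obtain ⟨r, hr, hrb⟩ := (h.level N).right b
  obtain ⟨M, hM⟩ := hx.exists_gap r (L N + 1)
  obtain ⟨p, hp, -⟩ := (h.level (N + (M + 1))).right b
  obtain ⟨s, h1, h2, h3⟩ := hM p
  have hsb : x (s + L N) = b := by
    rw [← hrb]
    exact factorAt_apply h3 (by positivity) (by push_cast; omega)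
  refine hb (hsb.symm.trans (hrun _ p hp s (((h.level N).mem_iff r hr s).2
    (factorAt_of_le (Nat.le_succ _) h3)) h1 ?_))
  push_cast
  omega

/-- The periods `ℓ n (c n)` tend to infinity: they never decrease, and increase whenever `c`
changes its value. -/
lemma tendsto_period (h : BispecialTower x S L ℓ c) (hk : 2 ≤ k) (hx : IsUniformlyRecurrent x) :
    Tendsto (fun n => ℓ n (c n)) atTop atTop := by
  have hmono : Monotone fun n => ℓ n (c n) := by
    refine monotone_nat_of_le_succ fun n => ?_
    rw [h.return_succ]
    split_ifs <;> omega
  refine tendsto_atTop_atTop_of_monotone hmono fun b => ?_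
  induction b with
  | zero => exact ⟨0, Nat.zero_le _⟩
  | succ b ih =>
    obtain ⟨N, hN⟩ := ih
    obtain ⟨n, hn, hc⟩ := h.exists_ne hk hx N
    refine ⟨n + 1, ?_⟩
    have h1 : ℓ N (c N) ≤ ℓ n (c n) := hmono hn
    have h2 := (h.level n).pos (c (n + 1))
    rw [h.return_succ, if_neg hc]
    omega

/-- If `c j = b` is the last occurrence of `b` before `m`, the `b`-return time of `w m` equals
`|w m| - |w j|`. -/
lemma return_add_length (h : BispecialTower x S L ℓ c) {j m : ℕ} (hjm : j < m)
    (hne : ∀ i, j < i → i < m → c i ≠ c j) : ℓ m (c j) + L j = L m := by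
  induction m, Nat.succ_le_of_lt hjm using Nat.le_induction with
  | base => rw [h.return_succ, if_pos rfl, h.length_succ, add_comm]
  | succ m hm ih =>
    have h1 := ih hm fun i hi him => hne i hi (him.trans (Nat.lt_succ_self m))
    rw [h.return_succ, if_neg (hne m hm (Nat.lt_succ_self m)).symm, h.length_succ]
    omega

lemma length_add_one_le (h : BispecialTower x S L ℓ c) (n m : ℕ) :
    L (n + m) + 1 ≤ 2 ^ m * (L n + 1) := by
  induction m with
  | zero => simp
  | succ m ih =>
    have h1 := (h.level (n + m)).le_length (c (n + m))
    rw [← add_assoc, h.length_succ, pow_succ]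
    linarith

/-- Three occurrences `j < m < i` of one letter in `c`, the first two of them successive, create
cubes: with the period `q = ℓ m (c m) = |w m| - |w j|`, the word `w (i + 1)` contains a
`q`-periodic factor of length `3 q + |w j|`, and it occurs in `x` with gaps of length at most
`|w (i + 1)| + 1`. -/
lemma exists_periodic (h : BispecialTower x S L ℓ c) (hk : 2 ≤ k) {j m i : ℕ} (hjm : j < m)
    (hmi : m < i) (hne : ∀ i, j < i → i < m → c i ≠ c j) (hcm : c m = c j) (hci : c i = c j)
    (r : ℤ) : ∃ p, r ≤ p ∧ p ≤ r + L (i + 1) ∧ ∀ t : ℤ, p ≤ t →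
      t < p + 2 * ℓ m (c m) + L j → x (t + ℓ m (c m)) = x t := by
  obtain ⟨s, hs, hrs, hsr⟩ := (h.level (i + 1)).exists_mem_between hk (r - L i + L (m + 1))
  obtain ⟨hsi, hsc⟩ := (h.mem_succ i s).1 hs
  have hp := h.suffix_mem (Nat.succ_le_of_lt hmi) hsi
  have hL := h.return_add_length hjm hne
  rw [← hcm] at hL
  obtain ⟨p, rfl⟩ : ∃ p, s = p - L i + L (m + 1) := ⟨s + L i - L (m + 1), by ring⟩
  rw [show p - L i + L (m + 1) + L i - L (m + 1) = p by ring] at hp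
  rw [show p - L i + L (m + 1) + L i = p + L (m + 1) by ring] at hsc
  refine ⟨p, by omega, by omega, fun t hpt htp => ?_⟩
  obtain ⟨hpm, hpc⟩ := (h.mem_succ m p).1 hp
  have hq := h.add_mem hp
  have hqc : x (p + ℓ m (c m) + L m) = c m := by
    rw [h.length_succ m, hci, ← hcm] at hsc
    rw [add_right_comm, add_assoc]
    exact_mod_cast hsc
  have hloop := (h.level m).loop p hpm _ hq (hpc.trans hqc.symm)
  rw [hpc] at hloop
  have := factorAt_apply hloop (s := t - p) (by omega) (by push_cast; omega)
  rw [add_sub_cancel, add_assoc, add_comm _ (t - p), ← add_assoc, add_sub_cancel] at this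
  exact this.symm

/-- Among `2 k + 1` consecutive values of `c` one letter occurs three times, and the lengths
`L n + 1` grow at most by a factor of two from one level to the next. -/
lemma exists_frequent_cubes (h : BispecialTower x S L ℓ c) (hk : 2 ≤ k) (n : ℕ) :
    ∃ m, n ≤ m ∧ ∃ g, 0 < g ∧ ∀ r : ℤ, ∃ p, r ≤ p ∧ p ≤ r + (2 ^ (2 * k + 1) * g : ℕ) ∧
      ∀ t : ℤ, p ≤ t → t + 1 < p + 2 * ℓ m (c m) + g → x (t + ℓ m (c m)) = x t := by
  obtain ⟨b, -, hb⟩ := Finset.exists_lt_card_fiber_of_mul_lt_card_of_maps_to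
    (s := Finset.Icc n (n + 2 * k)) (t := (Finset.univ : Finset (Fin k))) (f := c) (n := 2)
    (fun _ _ => Finset.mem_univ _) (by
      rw [Finset.card_univ, Fintype.card_fin, Nat.card_Icc]
      omega)
  set F := (Finset.Icc n (n + 2 * k)).filter fun i => c i = b with hF
  have hFmem : ∀ i, i ∈ F ↔ (n ≤ i ∧ i ≤ n + 2 * k) ∧ c i = b := fun i => by simp [hF]
  let e := F.orderEmbOfFin rfl
  have he : ∀ a, e a ∈ F := F.orderEmbOfFin_mem rfl
  set j₀ := e ⟨0, by omega⟩
  set m := e ⟨1, by omega⟩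
  set i := e ⟨2, hb⟩
  have h01 : j₀ < m := e.strictMono (by simp)
  have h12 : m < i := e.strictMono (by simp)
  have hne : (F.filter (· < m)).Nonempty := ⟨j₀, Finset.mem_filter.2 ⟨he _, h01⟩⟩
  obtain ⟨hjF, hjm⟩ := Finset.mem_filter.1 (Finset.max'_mem _ hne)
  set j := (F.filter (· < m)).max' hne
  obtain ⟨⟨hj1, hj2⟩, hjb⟩ := (hFmem j).1 hjF
  obtain ⟨⟨hm1, hm2⟩, hmb⟩ := (hFmem m).1 (he _)
  obtain ⟨⟨hi1, hi2⟩, hib⟩ := (hFmem i).1 (he _)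
  have hbetween : ∀ a, j < a → a < m → c a ≠ c j := by
    intro a ha1 ha2 hab
    have : a ≤ j := Finset.le_max' _ _
      (Finset.mem_filter.2 ⟨(hFmem a).2 ⟨⟨by omega, by omega⟩, hab.trans hjb⟩, ha2⟩)
    omega
  have hlen : L (i + 1) + 1 ≤ 2 ^ (2 * k + 1) * (L j + 1) := by
    have h1 := h.length_add_one_le j (i + 1 - j)
    rw [Nat.add_sub_cancel' (by omega)] at h1
    exact h1.trans (Nat.mul_le_mul_right _ (Nat.pow_le_pow_right two_pos (by omega)))
  refine ⟨m, hm1, L j + 1, Nat.succ_pos _, fun r => ?_⟩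
  obtain ⟨p, hp1, hp2, hp3⟩ :=
    h.exists_periodic hk hjm h12 hbetween (hmb.trans hjb.symm) (hib.trans hjb.symm) r
  exact ⟨p, hp1, by omega, fun t ht1 ht2 => hp3 t ht1 (by push_cast at ht2; omega)⟩

end BispecialTower

/-- Long cubes are frequent in an Arnoux-Rauzy sequence: for arbitrarily long periods `q n`,
a positive proportion of the positions (independent of `n`) begin a cube of period `q n`. -/
lemma IsArnouxRauzy.exists_frequent_cubes (hk : 2 ≤ k) (hx : IsArnouxRauzy x) :
    ∃ q g : ℕ → ℕ, Tendsto q atTop atTop ∧ ∀ n, 0 < g n ∧ ∀ r : ℤ,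
      ∃ p, r ≤ p ∧ p ≤ r + (2 ^ (2 * k + 1) * g n : ℕ) ∧
        ∀ t : ℤ, p ≤ t → t + 1 < p + 2 * q n + g n → x (t + q n) = x t := by
  obtain ⟨S, L, ℓ, c, h⟩ := hx.exists_tower hk
  choose m hm g hg using h.exists_frequent_cubes hk
  exact ⟨fun n => ℓ (m n) (c (m n)), g, (h.tendsto_period hk hx.uniformlyRecurrent).comp
    (tendsto_atTop_mono hm tendsto_id), hg⟩

end Towers

/-! ### Gordon's three-block argument -/

section Gordon

open Filter Topology

/-- The transfer matrix over a block of length `q` has determinant one and depends only on the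
potential in the block: here its four entries are `a b c d`. -/
lemma exists_transfer_entries (V : ℤ → ℝ) (E : ℂ) (r : ℤ) (q : ℕ) :
    ∃ a b c d : ℂ, a * d - b * c = 1 ∧ ∀ (u : ℤ → ℂ) (s : ℤ),
      (∀ n, u (n + 1) + u (n - 1) + (V n : ℂ) * u n = E * u n) →
      (∀ t : ℤ, 0 ≤ t → t < q → V (s + t) = V (r + t)) →
      u (s + q) = a * u s + b * u (s - 1) ∧ u (s + q - 1) = c * u s + d * u (s - 1) := by
  induction q with
  | zero => exact ⟨1, 0, 0, 1, by simp, by simp⟩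
  | succ q ih =>
    obtain ⟨a, b, c, d, hdet, h⟩ := ih
    refine ⟨(E - V (r + q)) * a - c, (E - V (r + q)) * b - d, a, b, by linear_combination hdet,
      fun u s hu hV => ?_⟩
    obtain ⟨h1, h2⟩ := h u s hu fun t ht htq => hV t ht (by push_cast; omega)
    have h3 := hu (s + q)
    rw [hV q (by positivity) (by push_cast; omega)] at h3
    push_cast
    rw [← add_assoc, add_sub_cancel_right]
    exact ⟨by linear_combination h3 + (E - V (r + q)) * h1 - h2, h1⟩

/-- The three-block argument of Gordon: by Cayley-Hamilton for the transfer matrix `M` over one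
period, `u (s + 2q) - tr M u (s + q) + u s = 0` and `u (s + q) - tr M u s + u (s - q) = 0`; the
first identity is used when `|tr M| ≤ 1` and the second one otherwise. -/
lemma norm_le_of_three_blocks {V : ℤ → ℝ} {E : ℂ} {s : ℤ} {q : ℕ}
    (hV : ∀ t : ℤ, -q ≤ t → t < q → V (s + t + q) = V (s + t)) {u : ℤ → ℂ}
    (hu : ∀ n, u (n + 1) + u (n - 1) + (V n : ℂ) * u n = E * u n) :
    ‖u s‖ ≤ ‖u (s + 2 * q)‖ + ‖u (s + q)‖ + ‖u (s - q)‖ ∧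
    ‖u (s - 1)‖ ≤ ‖u (s + 2 * q - 1)‖ + ‖u (s + q - 1)‖ + ‖u (s - q - 1)‖ := by
  obtain ⟨a, b, c, d, hdet, h⟩ := exists_transfer_entries V E s q
  obtain ⟨h1, h1'⟩ := h u s hu fun _ _ _ => rfl
  obtain ⟨h2, h2'⟩ := h u (s + q) hu fun t ht htq => by
    rw [← hV t (by omega) htq]
    congr 1
    ring
  obtain ⟨h0, h0'⟩ := h u (s - q) hu fun t ht htq => by
    have := hV (t - q) (by omega) (by omega)
    rw [show s + (t - q) + q = s + t by ring] at this
    rw [this]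
    congr 1
    ring
  rw [show s + (q : ℤ) + q = s + 2 * q by ring] at h2 h2'
  rw [sub_add_cancel] at h0 h0'
  have key : ∀ A B C : ℂ, A - (a + d) * B + C = 0 → ‖a + d‖ ≤ 1 → ‖C‖ ≤ ‖A‖ + ‖B‖ := by
    intro A B C hABC htr
    have : C = (a + d) * B - A := by linear_combination hABC
    rw [this]
    refine (norm_sub_le _ _).trans ?_
    rw [norm_mul]
    nlinarith [norm_nonneg B]
  have key' : ∀ A B C : ℂ, A - (a + d) * B + C = 0 → 1 ≤ ‖a + d‖ → ‖B‖ ≤ ‖A‖ + ‖C‖ := by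
    intro A B C hABC htr
    have : (a + d) * B = A + C := by linear_combination -hABC
    have h3 := norm_add_le A C
    rw [← this, norm_mul] at h3
    nlinarith [norm_nonneg B]
  rcases le_total ‖a + d‖ 1 with htr | htr
  · have e1 := key (u (s + 2 * q)) (u (s + q)) (u s)
      (by rw [h2, h1, h1']; linear_combination -u s * hdet) htr
    have e2 := key (u (s + 2 * q - 1)) (u (s + q - 1)) (u (s - 1))
      (by rw [h2', h1, h1']; linear_combination -u (s - 1) * hdet) htr
    exact ⟨by linarith [norm_nonneg (u (s - q))], by linarith [norm_nonneg (u (s - q - 1))]⟩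
  · have e1 := key' (u (s + q)) (u s) (u (s - q))
      (by rw [h1, h0, h0']; linear_combination -u (s - q) * hdet) htr
    have e2 := key' (u (s + q - 1)) (u (s - 1)) (u (s - q - 1))
      (by rw [h1', h0, h0']; linear_combination -u (s - q - 1) * hdet) htr
    exact ⟨by linarith [norm_nonneg (u (s + 2 * q))],
      by linarith [norm_nonneg (u (s + 2 * q - 1))]⟩

lemma eq_zero_of_eq_zero_pair {V : ℤ → ℝ} {E : ℂ} {u : ℤ → ℂ}
    (hu : ∀ n, u (n + 1) + u (n - 1) + (V n : ℂ) * u n = E * u n) {s : ℤ}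
    (h0 : u s = 0) (h1 : u (s - 1) = 0) (n : ℤ) : u n = 0 := by
  suffices h : u n = 0 ∧ u (n - 1) = 0 from h.1
  induction n using Int.inductionOn' (b := s) with
  | zero => exact ⟨h0, h1⟩
  | succ m _ ih =>
    have := hu m
    rw [ih.1, ih.2] at this
    rw [add_sub_cancel_right]
    exact ⟨by simpa using this, ih.1⟩
  | pred m _ ih =>
    have := hu (m - 1)
    rw [sub_add_cancel, ih.1, ih.2] at this
    exact ⟨ih.2, by simpa using this⟩

lemma tendsto_cofinite_zero (φ : EllTwo) : Tendsto (fun n : ℤ => φ n) cofinite (𝓝 0) := by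
  have h := (summable_sq φ).tendsto_cofinite_zero
  rw [tendsto_zero_iff_norm_tendsto_zero]
  have := h.sqrt
  simpa [Real.sqrt_sq] using this

/-- A potential with arbitrarily long cubes around a site has no eigenvectors. -/
lemma eq_zero_of_frequently_three_blocks {V : ℤ → ℝ} (hV : ∃ C : ℝ, ∀ n, |V n| ≤ C) {s : ℤ}
    {q : ℕ → ℕ} (hq : Tendsto q atTop atTop)
    (hs : ∃ᶠ n in atTop, ∀ t : ℤ, -q n ≤ t → t < q n → V (s + t + q n) = V (s + t))
    {E : ℂ} {φ : EllTwo} (hφ : schrodinger V hV φ = E • φ) : φ = 0 := by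
  have hu : ∀ n, φ (n + 1) + φ (n - 1) + (V n : ℂ) * φ n = E * φ n := fun n => by
    rw [← schrodinger_apply V hV, hφ]
    rfl
  have hlim : ∀ (m b : ℤ), m ≠ 0 → Tendsto (fun n => ‖φ (b + m * q n)‖) atTop (𝓝 0) := by
    intro m b hm
    have hinj : Function.Injective fun j : ℕ => b + m * (j : ℤ) := by
      intro i j hij
      have : m * (i : ℤ) = m * j := add_left_cancel hij
      exact_mod_cast mul_left_cancel₀ hm this
    have h1 := ((tendsto_cofinite_zero φ).comp hinj.tendsto_cofinite)
    rw [Nat.cofinite_eq_atTop] at h1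
    simpa using (h1.comp hq).norm
  have hzero : ∀ b : ℤ, (∃ᶠ n in atTop,
      ‖φ b‖ ≤ ‖φ (b + 2 * q n)‖ + ‖φ (b + 1 * q n)‖ + ‖φ (b + -1 * q n)‖) → φ b = 0 := by
    intro b hb
    have h1 := ((hlim 2 b (by norm_num)).add (hlim 1 b (by norm_num))).add
      (hlim (-1) b (by norm_num))
    simp only [add_zero] at h1
    exact norm_le_zero_iff.1 (ge_of_tendsto_of_frequently h1 hb)
  have h3 := hs.mono fun n hn => norm_le_of_three_blocks hn hu
  ext n
  refine eq_zero_of_eq_zero_pair hu (s := s) (hzero s (h3.mono fun n hn => ?_))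
    (hzero (s - 1) (h3.mono fun n hn => ?_)) n
  · simpa [sub_eq_add_neg] using hn.1
  · have e := hn.2
    rw [show s + 2 * (q n : ℤ) - 1 = s - 1 + 2 * q n by ring,
      show s + (q n : ℤ) - 1 = s - 1 + 1 * q n by ring,
      show s - (q n : ℤ) - 1 = s - 1 + -1 * q n by ring] at e
    exact e

end Gordon

/-! ### Spectral measures and eigenvectors -/

section Spectral

open Filter Topology MeasureTheory

lemma inner_translate (s : ℤ) (φ ψ : EllTwo) :
    inner ℂ (translate s φ) ψ = inner ℂ φ (translate (-s) ψ) := by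
  rw [lp.inner_eq_tsum, lp.inner_eq_tsum,
    ← (Equiv.addRight (-s)).tsum_eq (fun n : ℤ => inner ℂ ((translate s φ) n) (ψ n))]
  refine tsum_congr fun n => ?_
  change inner ℂ (φ (n + -s + s)) (ψ (n + -s)) = inner ℂ (φ n) (ψ (n + -s))
  rw [neg_add_cancel_right]

lemma inner_multiply (V : ℤ → ℝ) (hV : ∃ C : ℝ, ∀ n, |V n| ≤ C) (φ ψ : EllTwo) :
    inner ℂ (multiply V hV φ) ψ = inner ℂ φ (multiply V hV ψ) := by
  rw [lp.inner_eq_tsum, lp.inner_eq_tsum]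
  refine tsum_congr fun n => ?_
  change inner ℂ ((V n : ℂ) * φ n) (ψ n) = inner ℂ (φ n) ((V n : ℂ) * ψ n)
  simp only [RCLike.inner_apply, map_mul, Complex.conj_ofReal]
  ring

lemma isSelfAdjoint_schrodinger (V : ℤ → ℝ) (hV : ∃ C : ℝ, ∀ n, |V n| ≤ C) :
    IsSelfAdjoint (schrodinger V hV) := by
  rw [ContinuousLinearMap.isSelfAdjoint_iff_isSymmetric]
  intro φ ψ
  change inner ℂ (translate 1 φ + translate (-1) φ + multiply V hV φ) ψ =
    inner ℂ φ (translate 1 ψ + translate (-1) ψ + multiply V hV ψ)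
  rw [inner_add_left, inner_add_left, inner_add_right, inner_add_right, inner_translate,
    inner_translate, inner_multiply, neg_neg, add_comm (inner ℂ φ (translate (-1) ψ))]

variable {H : EllTwo →L[ℂ] EllTwo}

lemma sub_smul_inverse_apply (hH : IsSelfAdjoint H) {z : ℂ} (hz : 0 < z.im) (φ : EllTwo) :
    H (Ring.inverse (H - z • (1 : EllTwo →L[ℂ] EllTwo)) φ)
      - z • Ring.inverse (H - z • (1 : EllTwo →L[ℂ] EllTwo)) φ = φ := by
  have hu : IsUnit (H - z • (1 : EllTwo →L[ℂ] EllTwo)) := by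
    have h : z ∉ spectrum ℂ H := fun h => hz.ne' (hH.im_eq_zero_of_mem_spectrum h)
    rw [spectrum.notMem_iff, Algebra.algebraMap_eq_smul_one] at h
    simpa using h.neg
  have := congrArg (fun T : EllTwo →L[ℂ] EllTwo => T φ) (Ring.mul_inverse_cancel _ hu)
  simpa using this

/-- The identity `Im ⟨φ, (H - z)⁻¹ φ⟩ = Im z ‖(H - z)⁻¹ φ‖²`, with `ψ = (H - z)⁻¹ φ`. -/
lemma im_inner_sub_smul (hH : IsSelfAdjoint H) (z : ℂ) (ψ : EllTwo) :
    (inner ℂ (H ψ - z • ψ) ψ).im = z.im * ‖ψ‖ ^ 2 := by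
  have h1 : (inner ℂ (H ψ) ψ).im = 0 := hH.isSymmetric.im_inner_apply_self ψ
  rw [inner_sub_left, inner_smul_left, inner_self_eq_norm_sq_to_K, Complex.sub_im, h1]
  simp [← Complex.ofReal_pow]

lemma norm_le_of_sub_smul (hH : IsSelfAdjoint H) (z : ℂ) (ψ : EllTwo) :
    z.im * ‖ψ‖ ≤ ‖H ψ - z • ψ‖ := by
  rcases eq_or_ne ψ 0 with rfl | hψ
  · simp
  have h1 : z.im * ‖ψ‖ ^ 2 ≤ ‖H ψ - z • ψ‖ * ‖ψ‖ := by
    rw [← im_inner_sub_smul hH]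
    exact (Complex.im_le_norm _).trans (norm_inner_le_norm _ _)
  have h2 : 0 < ‖ψ‖ := norm_pos_iff.2 hψ
  nlinarith

/-- Rescaled Borel transforms recover the mass of a point. -/
lemma tendsto_borelTransform_atom (μ : Measure ℝ) [IsFiniteMeasure μ] (s : ℝ) :
    Tendsto (fun ε : ℝ => -(Complex.I * ε) * ∫ t : ℝ, 1 / ((t : ℂ) - (s + Complex.I * ε)) ∂μ)
      (𝓝[>] 0) (𝓝 (μ.real {s} : ℂ)) := by
  have h : ∀ ε : ℝ, -(Complex.I * ε) * ∫ t : ℝ, 1 / ((t : ℂ) - (s + Complex.I * ε)) ∂μ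
      = ∫ t : ℝ, -(Complex.I * ε) * (1 / ((t : ℂ) - (s + Complex.I * ε))) ∂μ := fun ε =>
    (integral_const_mul _ _).symm
  simp_rw [h]
  have h2 : (μ.real {s} : ℂ) = ∫ t : ℝ, Set.indicator {s} (fun _ => (1 : ℂ)) t ∂μ := by
    rw [integral_indicator (measurableSet_singleton s)]
    simp [Measure.real]
  rw [h2]
  refine tendsto_integral_filter_of_dominated_convergence (fun _ => (1 : ℝ)) ?_ ?_
    (integrable_const _) ?_
  · exact Eventually.of_forall fun ε => Measurable.aestronglyMeasurable (by fun_prop)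
  · filter_upwards [self_mem_nhdsWithin] with ε hε
    refine Eventually.of_forall fun t => ?_
    have hε' : (0 : ℝ) < ε := hε
    have h3 : ε ≤ ‖(t : ℂ) - (s + Complex.I * ε)‖ := by
      have := Complex.abs_im_le_norm ((t : ℂ) - (s + Complex.I * ε))
      simp only [Complex.sub_im, Complex.ofReal_im, Complex.add_im, Complex.mul_im, Complex.I_re,
        Complex.I_im, Complex.ofReal_re] at this
      rw [show (0 - (0 + (0 * 0 + 1 * ε)) : ℝ) = -ε by ring, abs_neg, abs_of_pos hε'] at this
      exact this
    rw [norm_mul, norm_neg, norm_mul, Complex.norm_I, Complex.norm_real, norm_div, norm_one,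
      one_mul, Real.norm_of_nonneg hε'.le, mul_one_div]
    exact div_le_one_of_le₀ h3 (norm_nonneg _)
  · refine Eventually.of_forall fun t => ?_
    by_cases hts : t = s
    · subst hts
      refine tendsto_const_nhds.congr' ?_
      filter_upwards [self_mem_nhdsWithin] with ε hε
      have : (ε : ℂ) ≠ 0 := by exact_mod_cast (ne_of_gt hε)
      simp only [Set.indicator_of_mem, Set.mem_singleton_iff]
      rw [sub_add_cancel_left, mul_one_div, div_self]
      exact neg_ne_zero.2 (mul_ne_zero Complex.I_ne_zero this)
    · rw [Set.indicator_of_notMem (by simpa using hts)]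
      have hc : ContinuousAt
          (fun ε : ℝ => -(Complex.I * ε) * (1 / ((t : ℂ) - (s + Complex.I * ε)))) 0 := by
        refine ContinuousAt.mul (by fun_prop) (ContinuousAt.div (by fun_prop) (by fun_prop) ?_)
        have : (t : ℂ) ≠ s := by exact_mod_cast hts
        simpa using sub_ne_zero.2 this
      have := hc.tendsto
      simp only [Complex.ofReal_zero, mul_zero, neg_zero, zero_mul] at this
      exact this.mono_left nhdsWithin_le_nhds

/-- Without an eigenvector at `s`, the range of `H - s` is dense, and pairing `φ` with it shows
that `ε ⟨φ, (H - s - iε)⁻¹ φ⟩` vanishes in the limit: spectral measures have no atom at `s`. -/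
lemma IsSpectralMeasure.measure_singleton_eq_zero (hH : IsSelfAdjoint H) {s : ℝ}
    (hs : ∀ ψ : EllTwo, H ψ = (s : ℂ) • ψ → ψ = 0) {φ : EllTwo} {μ : Measure ℝ}
    (hμ : IsSpectralMeasure H φ μ) : μ {s} = 0 := by
  have := hμ.1
  set T : EllTwo →L[ℂ] EllTwo := H - (s : ℂ) • 1 with hT
  have hTapp : ∀ ψ, T ψ = H ψ - (s : ℂ) • ψ := fun _ => rfl
  have hTsa : IsSelfAdjoint T := by
    refine hH.sub ?_
    rw [IsSelfAdjoint, star_smul, star_one]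
    simp
  have hdense : T.range.topologicalClosure = ⊤ := by
    rw [Submodule.topologicalClosure_eq_top_iff, ContinuousLinearMap.orthogonal_range,
      show ContinuousLinearMap.adjoint T = T from hTsa, Submodule.eq_bot_iff]
    intro ψ hψ
    refine hs ψ (sub_eq_zero.1 ?_)
    rw [← hTapp]
    exact hψ
  have hlim := tendsto_borelTransform_atom μ s
  have hzero : Tendsto (fun ε : ℝ =>
      -(Complex.I * ε) * ∫ t : ℝ, 1 / ((t : ℂ) - (s + Complex.I * ε)) ∂μ) (𝓝[>] 0) (𝓝 0) := by
    rw [Metric.tendsto_nhds]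
    intro δ hδ
    obtain ⟨χ, hχ⟩ : ∃ χ, ‖φ - T χ‖ * (‖φ‖ + 1) < δ / 2 := by
      have hmem : φ ∈ T.range.topologicalClosure := hdense ▸ Submodule.mem_top
      obtain ⟨_, ⟨χ, rfl⟩, hχ⟩ := Metric.mem_closure_iff.1 hmem (δ / 2 / (‖φ‖ + 1)) (by positivity)
      refine ⟨χ, ?_⟩
      rw [dist_eq_norm, lt_div_iff₀ (by positivity)] at hχ
      exact hχ
    have hε0 : ∀ᶠ ε : ℝ in 𝓝[>] 0, ε < δ / 2 / (2 * ‖χ‖ * ‖φ‖ + 1) :=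
      nhdsWithin_le_nhds (eventually_lt_nhds (by positivity))
    filter_upwards [self_mem_nhdsWithin, hε0] with ε hε hεδ
    have hεpos : (0 : ℝ) < ε := hε
    rw [lt_div_iff₀ (by positivity)] at hεδ
    have him : ((s : ℂ) + Complex.I * ε).im = ε := by simp
    rw [dist_zero_right, ← hμ.2 _ (by rw [him]; exact hεpos)]
    set ψ := Ring.inverse (H - ((s : ℂ) + Complex.I * ε) • (1 : EllTwo →L[ℂ] EllTwo)) φ
    have hψ : H ψ - ((s : ℂ) + Complex.I * ε) • ψ = φ :=
      sub_smul_inverse_apply hH (by rw [him]; exact hεpos) φ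
    have hnorm : ε * ‖ψ‖ ≤ ‖φ‖ := by
      have := norm_le_of_sub_smul hH ((s : ℂ) + Complex.I * ε) ψ
      rwa [hψ, him] at this
    have hTψ : T ψ = φ + (Complex.I * ε) • ψ := by
      rw [hTapp, ← hψ, add_smul]
      abel
    have hTn : ‖T ψ‖ ≤ 2 * ‖φ‖ := by
      rw [hTψ]
      refine (norm_add_le _ _).trans ?_
      rw [norm_smul, norm_mul, Complex.norm_I, Complex.norm_real, Real.norm_of_nonneg hεpos.le]
      linarith
    have hsplit : inner ℂ φ ψ = inner ℂ (φ - T χ) ψ + inner ℂ χ (T ψ) := by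
      have : inner ℂ (T χ) ψ = inner ℂ χ (T ψ) := hTsa.isSymmetric χ ψ
      rw [inner_sub_left, this, sub_add_cancel]
    have hb : ‖inner ℂ φ ψ‖ ≤ ‖φ - T χ‖ * ‖ψ‖ + ‖χ‖ * (2 * ‖φ‖) := by
      rw [hsplit]
      refine (norm_add_le _ _).trans (add_le_add (norm_inner_le_norm _ _) ?_)
      exact (norm_inner_le_norm _ _).trans (by gcongr)
    rw [norm_mul, norm_neg, norm_mul, Complex.norm_I, Complex.norm_real,
      Real.norm_of_nonneg hεpos.le, one_mul]
    calc ε * ‖inner ℂ φ ψ‖ ≤ ε * (‖φ - T χ‖ * ‖ψ‖ + ‖χ‖ * (2 * ‖φ‖)) := by gcongr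
      _ = ‖φ - T χ‖ * (ε * ‖ψ‖) + ε * (2 * ‖χ‖ * ‖φ‖) := by ring
      _ ≤ ‖φ - T χ‖ * (‖φ‖ + 1) + ε * (2 * ‖χ‖ * ‖φ‖ + 1) := by
          gcongr <;> linarith
      _ < δ := by linarith
  have h0 := tendsto_nhds_unique hlim hzero
  rwa [Complex.ofReal_eq_zero, measureReal_eq_zero_iff] at h0

/-- An operator without eigenvectors has trivial pure point space, hence empty pure point
spectrum. -/
lemma purePointSpectrum_eq_empty (hH : IsSelfAdjoint H)
    (hev : ∀ (s : ℝ) (ψ : EllTwo), H ψ = (s : ℂ) • ψ → ψ = 0) : purePointSpectrum H = ∅ := by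
  have hspace : purePointSpace H = {0} := by
    refine Set.eq_singleton_iff_unique_mem.2 ⟨⟨0, ⟨inferInstance, by simp⟩, ∅, by simp⟩, ?_⟩
    rintro φ ⟨μ, hμ, S, hS, hSc⟩
    have hS0 : μ S = 0 := by
      rw [← Set.biUnion_of_singleton S, measure_biUnion_null_iff hS]
      exact fun s _ => hμ.measure_singleton_eq_zero hH (hev s)
    have hμ0 : μ = 0 := by
      rw [← Measure.measure_univ_eq_zero, ← Set.union_compl_self S]
      exact measure_union_null hS0 hSc
    have hI : 0 < Complex.I.im := by simp
    have h1 := hμ.2 Complex.I hI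
    rw [hμ0, integral_zero_measure] at h1
    have h2 := sub_smul_inverse_apply hH hI φ
    set ψ := Ring.inverse (H - Complex.I • (1 : EllTwo →L[ℂ] EllTwo)) φ
    have h3 := im_inner_sub_smul hH Complex.I ψ
    rw [h2, h1] at h3
    have h4 : ψ = 0 := by simpa using h3.symm
    rw [← h2, h4]
    simp
  ext z
  simp only [purePointSpectrum, hspace, Set.mem_ofPred_eq, Set.mem_empty_iff_false, iff_false,
    not_not]
  refine Set.bijOn_singleton.2 (by simp)

end Spectral

/-! ### Almost every sequence -/

section AlmostEvery

open Filter Topology MeasureTheory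

variable {k : ℕ}

/-- The sequences that have period `q` on the three blocks `[-q, 0)`, `[0, q)`, `[q, 2q)`. -/
def threeBlocks (k q : ℕ) : Set (ℤ → Fin k) :=
  {y | ∀ t : ℤ, -q ≤ t → t < q → y (t + q) = y t}

lemma shift_iterate_apply (y : ℤ → Fin k) (n : ℕ) (t : ℤ) : shift^[n] y t = y (t + n) := by
  induction n generalizing t with
  | zero => simp
  | succ n ih =>
    rw [Function.iterate_succ_apply']
    change shift^[n] y (t + 1) = _
    rw [ih]
    push_cast
    congr 1
    ring

lemma measurableSet_eval_eq (s t : ℤ) : MeasurableSet {y : ℤ → Fin k | y s = y t} :=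
  measurableSet_eq_fun (measurable_pi_apply s) (measurable_pi_apply t)

lemma measurableSet_threeBlocks (k q : ℕ) : MeasurableSet (threeBlocks k q) := by
  simp only [threeBlocks, Set.ofPred_forall]
  exact MeasurableSet.iInter fun t => MeasurableSet.iInter fun _ => MeasurableSet.iInter fun _ =>
    measurableSet_eval_eq _ _

lemma exists_eq_of_mem_subshift {x y : ℤ → Fin k} (hy : y ∈ subshift x) (r : ℤ) (n : ℕ) :
    ∃ r', ∀ t : ℤ, 0 ≤ t → t < n → y (r + t) = x (r' + t) := by
  have h1 := factorAt_mem (x := y) r n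
  rw [hy n] at h1
  obtain ⟨r', hr'⟩ := h1
  refine ⟨r', fun t ht htn => ?_⟩
  lift t to ℕ using ht
  rw [factorAt, List.ofFn_inj, funext_iff] at hr'
  exact hr' ⟨t, by exact_mod_cast htn⟩

/-- If almost every orbit spends `g` successive times among the first `(D + 1) g` in `A`, then
`A` carries at least the fraction `1 / (D + 1)` of the total mass of the invariant measure. -/
lemma measure_univ_le_of_frequent_visits {α : Type*} [MeasurableSpace α] {T : α → α}
    {μ : Measure α} (hT : MeasurePreserving T μ μ) {A : Set α} (hA : MeasurableSet A)
    {D g : ℕ} (hg : 0 < g)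
    (h : ∀ᵐ y ∂μ, ∃ i ≤ D * g, ∀ j < g, T^[i + j] y ∈ A) :
    μ Set.univ ≤ (D + 1 : ℕ) * μ A := by
  have h1 : ∫⁻ y, ∑ i ∈ Finset.range ((D + 1) * g), (T^[i] ⁻¹' A).indicator 1 y ∂μ =
      ((D + 1) * g : ℕ) * μ A := by
    rw [lintegral_finsetSum]
    · simp_rw [lintegral_indicator_one ((hT.iterate _).measurable hA),
        (hT.iterate _).measure_preimage hA.nullMeasurableSet]
      simp
    · exact fun i _ => measurable_one.indicator ((hT.iterate i).measurable hA)
  have h2 : (g : ENNReal) * μ Set.univ ≤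
      ∫⁻ y, ∑ i ∈ Finset.range ((D + 1) * g), (T^[i] ⁻¹' A).indicator 1 y ∂μ := by
    rw [← lintegral_const]
    refine lintegral_mono_ae ?_
    filter_upwards [h] with y hy
    obtain ⟨i, hi, hiA⟩ := hy
    calc (g : ENNReal) = ∑ n ∈ Finset.Ico i (i + g), 1 := by simp
      _ ≤ ∑ n ∈ Finset.Ico i (i + g), (T^[n] ⁻¹' A).indicator 1 y := by
        refine Finset.sum_le_sum fun n hn => ?_
        obtain ⟨hn1, hn2⟩ := Finset.mem_Ico.1 hn
        have := hiA (n - i) (by omega)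
        rw [Nat.add_sub_cancel' hn1] at this
        rw [Set.indicator_of_mem (show y ∈ T^[n] ⁻¹' A from this)]
        rfl
      _ ≤ _ := by
        refine Finset.sum_le_sum_of_subset fun n hn => ?_
        obtain ⟨hn1, hn2⟩ := Finset.mem_Ico.1 hn
        rw [Finset.mem_range, add_mul, one_mul]
        omega
  rw [h1] at h2
  push_cast at h2 ⊢
  rw [mul_right_comm, mul_comm] at h2
  exact (ENNReal.mul_le_mul_iff_left (by exact_mod_cast hg.ne') (ENNReal.natCast_ne_top g)).1 h2

/-- Borel-Cantelli in the form: sets whose measures stay above a fixed proportion of the total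
mass cannot have a null limit superior. -/
lemma measure_univ_eq_zero_of_frequently {α : Type*} [MeasurableSpace α] {μ : Measure α}
    [IsFiniteMeasure μ] {A : ℕ → Set α} (hA : ∀ n, MeasurableSet (A n)) {C : ℕ}
    (hC : ∀ n, μ Set.univ ≤ C * μ (A n)) (h : ∀ᵐ y ∂μ, ¬ ∃ᶠ n in atTop, y ∈ A n) :
    μ Set.univ = 0 := by
  have hU : ∀ n, MeasurableSet (⋃ m ≥ n, A m) := fun n =>
    MeasurableSet.iUnion fun m => MeasurableSet.iUnion fun _ => hA m
  have h1 := tendsto_measure_iInter_atTop (μ := μ) (s := fun n => ⋃ m ≥ n, A m)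
    (fun n => (hU n).nullMeasurableSet)
    (fun n n' hn => Set.biUnion_subset_biUnion_left fun m hm => le_trans hn hm)
    ⟨0, measure_ne_top _ _⟩
  have h2 : μ (⋂ n, ⋃ m ≥ n, A m) = 0 := by
    refine measure_mono_null (fun y hy => ?_) h
    simp only [Set.mem_iInter, Set.mem_iUnion] at hy
    intro hcon
    refine hcon (frequently_atTop.2 fun n => ?_)
    obtain ⟨m, hm, hym⟩ := hy n
    exact ⟨m, hm, hym⟩
  rw [h2] at h1
  have h3 := ENNReal.Tendsto.const_mul (a := (C : ENNReal)) h1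
    (Or.inr (ENNReal.natCast_ne_top C))
  rw [mul_zero] at h3
  refine le_antisymm (ge_of_tendsto' h3 fun n => (hC n).trans ?_) zero_le
  refine mul_le_mul_right (measure_mono fun y hy => ?_) _
  exact Set.mem_biUnion (show n ≥ n from le_rfl) hy

/-- Every factor of `y` is a factor of `x`, so the cubes that are frequent in `x` are frequent in
`y` too. The search starts at `-q`: a cube beginning at `p` puts the site `p + q` in its middle
block, and this site must lie to the right of the origin. -/
lemma exists_visits_threeBlocks {x y : ℤ → Fin k} (hy : y ∈ subshift x) {q g D : ℕ}
    (h : ∀ r : ℤ, ∃ p, r ≤ p ∧ p ≤ r + (D * g : ℕ) ∧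
        ∀ t : ℤ, p ≤ t → t + 1 < p + 2 * q + g → x (t + q) = x t) :
    ∃ i ≤ D * g, ∀ j < g, shift^[i + j] y ∈ threeBlocks k q := by
  obtain ⟨r, hr⟩ := exists_eq_of_mem_subshift hy (-q) (D * g + 3 * q + g)
  obtain ⟨p, hp1, hp2, hp⟩ := h r
  obtain ⟨i, hi⟩ := Int.eq_ofNat_of_zero_le (sub_nonneg.2 hp1)
  change p - r = (i : ℤ) at hi
  refine ⟨i, by omega, fun j hj t ht1 ht2 => ?_⟩
  rw [shift_iterate_apply, shift_iterate_apply]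
  have h1 := hr (t + i + j + q) (by omega) (by push_cast at hp2 ⊢; omega)
  have h2 := hr (t + i + j + 2 * q) (by omega) (by push_cast at hp2 ⊢; omega)
  have h3 := hp (r + (t + i + j + q)) (by omega) (by omega)
  rw [show t + q + ((i + j : ℕ) : ℤ) = -q + (t + i + j + 2 * q) by push_cast; ring,
    show t + ((i + j : ℕ) : ℤ) = -q + (t + i + j + q) by push_cast; ring, h1, h2, ← h3]
  congr 1
  ring

/-- For almost every `y`, some site of `y` is surrounded by arbitrarily long cubes. The set of
such `y` is shift invariant, so `ν` restricted to its complement is an invariant measure, for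
which the cubes are frequent as well. -/
lemma IsArnouxRauzy.ae_frequently_three_blocks {x : ℤ → Fin k} (hk : 2 ≤ k)
    (hx : IsArnouxRauzy x) {ν : Measure (ℤ → Fin k)} [IsFiniteMeasure ν]
    (hinv : MeasurePreserving shift ν ν) (hsupp : ∀ᵐ y ∂ν, y ∈ subshift x) :
    ∃ q : ℕ → ℕ, Tendsto q atTop atTop ∧ ∀ᵐ y ∂ν, ∃ s : ℤ, ∃ᶠ n in atTop,
      ∀ t : ℤ, -q n ≤ t → t < q n → y (s + t + q n) = y (s + t) := by
  obtain ⟨q, g, hq, hcubes⟩ := hx.exists_frequent_cubes hk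
  refine ⟨q, hq, ?_⟩
  set B : Set (ℤ → Fin k) := {y | ∃ s : ℤ, ∃ᶠ n in atTop,
      ∀ t : ℤ, -q n ≤ t → t < q n → y (s + t + q n) = y (s + t)} with hB
  have hBmeas : MeasurableSet B := by
    simp only [hB, frequently_atTop, Set.ofPred_exists, Set.ofPred_forall, Set.ofPred_and]
    refine MeasurableSet.iUnion fun s => MeasurableSet.iInter fun n => MeasurableSet.iUnion
      fun m => (MeasurableSet.const _).inter ?_
    exact MeasurableSet.iInter fun t => MeasurableSet.iInter fun _ => MeasurableSet.iInter
      fun _ => measurableSet_eval_eq _ _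
  have hBinv : shift ⁻¹' Bᶜ = Bᶜ := by
    rw [Set.preimage_compl]
    congr 1
    ext y
    constructor
    · rintro ⟨s, hs⟩
      refine ⟨s + 1, hs.mono fun n hn t ht1 ht2 => ?_⟩
      have := hn t ht1 ht2
      change y (s + t + q n + 1) = y (s + t + 1) at this
      convert this using 2 <;> ring
    · rintro ⟨s, hs⟩
      refine ⟨s - 1, hs.mono fun n hn t ht1 ht2 => ?_⟩
      have := hn t ht1 ht2
      change y (s - 1 + t + q n + 1) = y (s - 1 + t + 1)
      convert this using 2 <;> ring
  have hμ : MeasurePreserving shift (ν.restrict Bᶜ) (ν.restrict Bᶜ) := by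
    have := hinv.restrict_preimage hBmeas.compl
    rwa [hBinv] at this
  have h1 : ∀ n, ν.restrict Bᶜ Set.univ ≤
      (2 ^ (2 * k + 1) + 1 : ℕ) * ν.restrict Bᶜ (threeBlocks k (q n)) := fun n => by
    refine measure_univ_le_of_frequent_visits hμ (measurableSet_threeBlocks k _) (hcubes n).1 ?_
    filter_upwards [ae_restrict_of_ae hsupp] with y hy
    exact exists_visits_threeBlocks hy (hcubes n).2
  have h2 := measure_univ_eq_zero_of_frequently
    (fun n => measurableSet_threeBlocks k (q n)) h1 (by
      filter_upwards [ae_restrict_mem hBmeas.compl] with y hy hcon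
      refine hy ⟨0, hcon.mono fun n hn t ht1 ht2 => ?_⟩
      rw [zero_add]
      exact hn t ht1 ht2)
  rw [Measure.restrict_apply_univ] at h2
  exact h2

end AlmostEvery

end ArnouxRauzy

theorem mainTheorem6 (k : ℕ) (hk : 2 ≤ k)
    (x : ℤ → Fin k) (hx : ArnouxRauzy.IsArnouxRauzy x)
    (i : ℕ → Fin k) (hi : ArnouxRauzy.IsIndexSequence x i)
    (f : Fin k → ℝ) (hf : ∃ a b : Fin k, f a ≠ f b)
    (hruns : {p : Fin k × ℕ | ArnouxRauzy.IsRun i 2 p}.Infinite)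
    (ν : MeasureTheory.Measure (ℤ → Fin k)) [MeasureTheory.IsProbabilityMeasure ν]
    (hinv : MeasureTheory.MeasurePreserving ArnouxRauzy.shift ν ν)
    (hsupp : ∀ᵐ y ∂ν, y ∈ ArnouxRauzy.subshift x) :
    ∀ᵐ y ∂ν, ArnouxRauzy.purePointSpectrum (ArnouxRauzy.symbolicSchrodinger f y) = ∅ := by
  obtain ⟨q, hq, hae⟩ := hx.ae_frequently_three_blocks hk hinv hsupp
  filter_upwards [hae] with y hy
  obtain ⟨s, hs⟩ := hy
  refine ArnouxRauzy.purePointSpectrum_eq_empty (ArnouxRauzy.isSelfAdjoint_schrodinger _ _)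
    fun E ψ hψ => ArnouxRauzy.eq_zero_of_frequently_three_blocks _ (s := s) hq
      (hs.mono fun n hn t ht1 ht2 => ?_) hψ
  exact congrArg f (hn t ht1 ht2)
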